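/- Let $\mathbb{D}=\{z\in\mathbb{C}:|z|<1\}$, and let $\mathcal{A}$ be the class of functions $f$ analytic in $\mathbb{D}$ with $f(0)=0$ and $f'(0)=1$, written $f(z)=\sum_{n\ge 1}a_nz^n$ with $a_1=1$. Let $\mathcal{S}^*_{\wp}$ be the class of all $f\in\mathcal{A}$ such that $zf'(z)/f(z)\prec 1+ze^z$; that is, $f(z)\neq 0$ for $z\in\mathbb{D}\setminus\{0\}$, and there is an analytic function $w:\mathbb{D}\to\mathbb{D}$ with $w(0)=0$ and $$\frac{zf'(z)}{f(z)}=1+w(z)e^{w(z)}\qquad(z\in\mathbb{D}),$$ where the left-hand side is given its limiting value $1$ at $z=0$. Let $$H_3(1)=\begin{vmatrix}a_1&a_2&a_3\\ a_2&a_3&a_4\\ a_3&a_4&a_5\end{vmatrix}$$ be the third Hankel determinant of $f$. Then every $f\in\mathcal{S}^*_{\wp}$ satisfies $$|H_3(1)|\le\frac19 .$$ The bound is sharp: the function $f(z)=z\exp\left(\frac{e^{z^3}-1}{3}\right)$ belongs to $\mathcal{S}^*_{\wp}$ and satisfies $|H_3(1)|=\frac19$. -/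

import Mathlib

/-- The class `𝒜`: functions holomorphic on the open unit disc with `f 0 = 0` and `f' 0 = 1`. -/
def IsNormalizedAnalytic (f : ℂ → ℂ) : Prop :=
  DifferentiableOn ℂ f (Metric.ball 0 1) ∧ f 0 = 0 ∧ deriv f 0 = 1

/-- Subordination `F ≺ G` on the open unit disc: `F = G ∘ w` on the disc for some holomorphic
self-map `w` of the disc with `w 0 = 0` (a Schwarz function). -/
def IsSubordinate (F G : ℂ → ℂ) : Prop :=
  ∃ w : ℂ → ℂ, DifferentiableOn ℂ w (Metric.ball 0 1) ∧
    Set.MapsTo w (Metric.ball 0 1) (Metric.ball 0 1) ∧ w 0 = 0 ∧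
    ∀ z ∈ Metric.ball (0 : ℂ) 1, F z = G (w z)

/-- The function `z f'(z) / f(z)`, with its removable singularity at the origin filled by `1`,
the limit there for `f` in the class `𝒜`. -/
noncomputable def starlikeQuotient (f : ℂ → ℂ) (z : ℂ) : ℂ :=
  if z = 0 then 1 else z * deriv f z / f z

/-- The Ma-Minda class `𝒮*(φ)`: those `f` in `𝒜` with `z f'(z) / f(z) ≺ φ(z)`. The quotient is
to be defined on the disc, so `f` has no zero there besides the origin. -/
def MaMindaStarlike (φ : ℂ → ℂ) : Set (ℂ → ℂ) :=
  {f | IsNormalizedAnalytic f ∧ (∀ z ∈ Metric.ball (0 : ℂ) 1, z ≠ 0 → f z ≠ 0) ∧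
    IsSubordinate (starlikeQuotient f) φ}

/-- The class `𝒮*_℘ = 𝒮*(1 + z e^z)`. -/
noncomputable def StarlikeCardioid : Set (ℂ → ℂ) :=
  MaMindaStarlike fun z => 1 + z * Complex.exp z

/-- The `n`-th Taylor coefficient `a_n` of `f` at the origin. -/
noncomputable def taylorCoeff (f : ℂ → ℂ) (n : ℕ) : ℂ :=
  iteratedDeriv n f 0 / (n.factorial : ℂ)

/-- The Hankel determinant `H_q(n)` of `f`: the `q × q` determinant with entries
`a_{n + i + j}`, `0 ≤ i, j < q`. -/
noncomputable def hankelDet (f : ℂ → ℂ) (q n : ℕ) : ℂ :=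
  (Matrix.of fun i j : Fin q => taylorCoeff f (n + i + j)).det

/-! Comparing coefficients in `z f' = f (1 + w e^w)` turns `144 H_3(1)` into a polynomial in the
first four coefficients of the Schwarz function `w` (`hankelDet_three_one_eq`). The Schur algorithm,
applied to `w(z)/z`, writes these coefficients through four free parameters `a, b, g, d` of the
closed unit disc (`exists_schur_parameters`). Sorted into monomials with real coefficients, the
polynomial is bounded by the triangle inequality; the resulting bound is largest at `|g| = |d| = 1`,
which leaves a polynomial in `|a|` and `|b|` that is at most 16 (`majorant_le`). Equality at `a = b
= 0`, `|g| = 1` points to `w = z^3`, the extremal function. -/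

/-- The Taylor series at the origin, as a formal power series. -/
noncomputable def taylorSeries (f : ℂ → ℂ) : PowerSeries ℂ :=
  PowerSeries.mk (taylorCoeff f)

@[simp]
theorem coeff_taylorSeries (f : ℂ → ℂ) (n : ℕ) :
    PowerSeries.coeff n (taylorSeries f) = taylorCoeff f n := by
  simp [taylorSeries]

@[simp]
theorem taylorCoeff_zero (f : ℂ → ℂ) : taylorCoeff f 0 = f 0 := by
  simp [taylorCoeff]

theorem taylorCoeff_one (f : ℂ → ℂ) : taylorCoeff f 1 = deriv f 0 := by
  simp [taylorCoeff]

theorem taylorSeries_congr {f g : ℂ → ℂ}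
    (h : ∀ z ∈ Metric.ball (0 : ℂ) 1, f z = g z) : taylorSeries f = taylorSeries g := by
  ext n
  have : f =ᶠ[nhds 0] g :=
    Filter.eventually_of_mem (Metric.ball_mem_nhds 0 one_pos) h
  simp [taylorCoeff, this.iteratedDeriv_eq]

theorem taylorSeries_add {f g : ℂ → ℂ} (hf : AnalyticAt ℂ f 0) (hg : AnalyticAt ℂ g 0) :
    taylorSeries (fun z => f z + g z) = taylorSeries f + taylorSeries g := by
  ext n
  simp [taylorCoeff, iteratedDeriv_fun_add hf.contDiffAt hg.contDiffAt, add_div]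

theorem taylorSeries_mul {f g : ℂ → ℂ} (hf : AnalyticAt ℂ f 0) (hg : AnalyticAt ℂ g 0) :
    taylorSeries (fun z => f z * g z) = taylorSeries f * taylorSeries g := by
  ext n
  rw [PowerSeries.coeff_mul, coeff_taylorSeries, taylorCoeff,
    iteratedDeriv_fun_mul hf.contDiffAt hg.contDiffAt,
    Finset.Nat.sum_antidiagonal_eq_sum_range_succ_mk, Finset.sum_div]
  refine Finset.sum_congr rfl fun k hk => ?_
  have hk' : k ≤ n := Nat.lt_succ_iff.mp (Finset.mem_range.mp hk)
  have h1 : (k.factorial : ℂ) ≠ 0 := by exact_mod_cast k.factorial_ne_zero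
  have h2 : ((n - k).factorial : ℂ) ≠ 0 := by exact_mod_cast (n - k).factorial_ne_zero
  have h3 : (n.factorial : ℂ) ≠ 0 := by exact_mod_cast n.factorial_ne_zero
  simp only [coeff_taylorSeries, taylorCoeff, Nat.cast_choose ℂ hk']
  field_simp

@[simp]
theorem taylorSeries_const (c : ℂ) : taylorSeries (fun _ => c) = PowerSeries.C c := by
  ext n
  cases n <;> simp [taylorCoeff, iteratedDeriv_const, PowerSeries.coeff_C]

@[simp]
theorem taylorSeries_id : taylorSeries (fun z => z) = PowerSeries.X := by
  ext n
  rcases n with _ | _ | n <;> simp [taylorCoeff, PowerSeries.coeff_X, iteratedDeriv_succ']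

theorem taylorCoeff_deriv (f : ℂ → ℂ) (n : ℕ) :
    taylorCoeff (deriv f) n = (n + 1) * taylorCoeff f (n + 1) := by
  have h : (n.factorial : ℂ) ≠ 0 := by exact_mod_cast n.factorial_ne_zero
  have h' : (n + 1 : ℂ) ≠ 0 := by exact_mod_cast n.succ_ne_zero
  simp only [taylorCoeff, iteratedDeriv_succ', Nat.factorial_succ]
  push_cast
  field_simp

theorem analyticAt_zero_of_differentiableOn_ball {f : ℂ → ℂ}
    (hf : DifferentiableOn ℂ f (Metric.ball 0 1)) : AnalyticAt ℂ f 0 :=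
  hf.analyticAt (Metric.ball_mem_nhds 0 one_pos)

/-! ### Schur parameters of a Schwarz function -/

/-- One step of the Schur algorithm. -/
theorem exists_schur_step {φ : ℂ → ℂ} (hd : DifferentiableOn ℂ φ (Metric.ball 0 1))
    (hm : ∀ z ∈ Metric.ball (0 : ℂ) 1, ‖φ z‖ ≤ 1) :
    ∃ ψ : ℂ → ℂ, DifferentiableOn ℂ ψ (Metric.ball 0 1) ∧
      (∀ z ∈ Metric.ball (0 : ℂ) 1, ‖ψ z‖ ≤ 1) ∧
      ∀ z ∈ Metric.ball (0 : ℂ) 1,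
        φ z * (1 + starRingEnd ℂ (φ 0) * (z * ψ z)) = φ 0 + z * ψ z := by
  have h0 : (0 : ℂ) ∈ Metric.ball (0 : ℂ) 1 := Metric.mem_ball_self one_pos
  rcases (hm 0 h0).lt_or_eq with ha | ha
  · have hden : ∀ z ∈ Metric.ball (0 : ℂ) 1, 1 - starRingEnd ℂ (φ 0) * φ z ≠ 0 := by
      intro z hz h
      have h1 : ‖starRingEnd ℂ (φ 0) * φ z‖ = 1 := by
        rw [← sub_eq_zero.mp h, norm_one]
      rw [norm_mul, RCLike.norm_conj] at h1
      nlinarith [hm z hz, norm_nonneg (φ 0), norm_nonneg (φ z)]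
    -- A disc automorphism moves `φ 0` to the origin; the Schwarz lemma then lets `z` be divided out
    -- of `g`, and the quotient is `ψ`.
    set g : ℂ → ℂ := fun z => (φ z - φ 0) / (1 - starRingEnd ℂ (φ 0) * φ z) with hg
    have hg0 : g 0 = 0 := by simp [hg]
    have hgd : DifferentiableOn ℂ g (Metric.ball 0 1) :=
      (hd.sub_const _).div ((hd.const_mul _).const_sub _) hden
    have hgm : Set.MapsTo g (Metric.ball 0 1) (Metric.closedBall (g 0) 1) := by
      intro z hz
      rw [hg0, mem_closedBall_zero_iff, hg, norm_div,
        div_le_one (norm_pos_iff.mpr (hden z hz))]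
      have key : ‖1 - starRingEnd ℂ (φ 0) * φ z‖ ^ 2 - ‖φ z - φ 0‖ ^ 2 =
          (1 - ‖φ 0‖ ^ 2) * (1 - ‖φ z‖ ^ 2) := by
        simp only [← Complex.normSq_eq_norm_sq, Complex.normSq_apply, Complex.sub_re,
          Complex.sub_im, Complex.mul_re, Complex.mul_im, Complex.conj_re, Complex.conj_im,
          Complex.one_re, Complex.one_im]
        ring
      have h1 : 0 ≤ 1 - ‖φ 0‖ ^ 2 := by nlinarith [norm_nonneg (φ 0)]
      have h2 : 0 ≤ 1 - ‖φ z‖ ^ 2 := by nlinarith [norm_nonneg (φ z), hm z hz]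
      refine le_of_sq_le_sq ?_ (norm_nonneg _)
      nlinarith [mul_nonneg h1 h2]
    refine ⟨dslope g 0,
      (Complex.differentiableOn_dslope (Metric.ball_mem_nhds 0 one_pos)).mpr hgd,
      fun z hz => by simpa using Complex.norm_dslope_le_div_of_mapsTo_ball hgd hgm hz,
      fun z hz => ?_⟩
    have hz' : z * dslope g 0 z = g z := by
      simpa using sub_smul_dslope_of_zero hg0 z
    have hg' : g z * (1 - starRingEnd ℂ (φ 0) * φ z) = φ z - φ 0 := div_mul_cancel₀ _ (hden z hz)
    rw [hz']
    linear_combination -hg'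
  -- If `|φ 0| = 1`, the maximum principle makes `φ` constant, and `ψ = 0` serves.
  · refine ⟨fun _ => 0, differentiableOn_const _, by simp, fun z hz => ?_⟩
    have hmax : IsMaxOn (norm ∘ φ) (Metric.ball 0 1) 0 :=
      isMaxOn_iff.mpr fun z hz => by simpa [ha] using hm z hz
    simpa using Complex.eqOn_of_isPreconnected_of_isMaxOn_norm
      (convex_ball (0 : ℂ) 1).isPreconnected Metric.isOpen_ball hd h0 hmax hz

/-- The recursion between the Taylor coefficients in one step of the Schur algorithm. -/
theorem taylorCoeff_succ_schur_step {φ ψ : ℂ → ℂ}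
    (hφ : DifferentiableOn ℂ φ (Metric.ball 0 1)) (hψ : DifferentiableOn ℂ ψ (Metric.ball 0 1))
    (h : ∀ z ∈ Metric.ball (0 : ℂ) 1,
      φ z * (1 + starRingEnd ℂ (φ 0) * (z * ψ z)) = φ 0 + z * ψ z) (n : ℕ) :
    taylorCoeff φ (n + 1) = taylorCoeff ψ n - starRingEnd ℂ (φ 0) *
      ∑ p ∈ Finset.HasAntidiagonal.antidiagonal n, taylorCoeff φ p.1 * taylorCoeff ψ p.2 := by
  have hφ0 := analyticAt_zero_of_differentiableOn_ball hφ
  have hψ0 := analyticAt_zero_of_differentiableOn_ball hψ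
  have hz : AnalyticAt ℂ (fun z : ℂ => z) 0 := analyticAt_id
  have hzψ : AnalyticAt ℂ (fun z => z * ψ z) 0 := hz.mul hψ0
  have hczψ : AnalyticAt ℂ (fun z => starRingEnd ℂ (φ 0) * (z * ψ z)) 0 :=
    analyticAt_const.mul hzψ
  have hden : AnalyticAt ℂ (fun z => 1 + starRingEnd ℂ (φ 0) * (z * ψ z)) 0 :=
    analyticAt_const.add hczψ
  have key := taylorSeries_congr h
  rw [taylorSeries_mul hφ0 hden, taylorSeries_add analyticAt_const hczψ,
    taylorSeries_add analyticAt_const hzψ, taylorSeries_mul analyticAt_const hzψ,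
    taylorSeries_mul hz hψ0,
    taylorSeries_const, taylorSeries_const, taylorSeries_const, taylorSeries_id] at key
  have key' : taylorSeries φ + PowerSeries.X * (PowerSeries.C (starRingEnd ℂ (φ 0)) *
      (taylorSeries φ * taylorSeries ψ)) =
      PowerSeries.C (φ 0) + PowerSeries.X * taylorSeries ψ := by
    rw [← key, map_one]; ring
  have := congrArg (PowerSeries.coeff (n + 1)) key'
  simp only [map_add, PowerSeries.coeff_succ_X_mul, PowerSeries.coeff_C_mul,
    coeff_taylorSeries, PowerSeries.coeff_C, Nat.succ_ne_zero, if_false, zero_add] at this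
  simp only [PowerSeries.coeff_mul, coeff_taylorSeries] at this
  rw [← this]; ring

/-- The first four Taylor coefficients of a Schwarz function in terms of its Schur parameters. -/
theorem exists_schur_parameters {w : ℂ → ℂ} (hd : DifferentiableOn ℂ w (Metric.ball 0 1))
    (hm : Set.MapsTo w (Metric.ball 0 1) (Metric.ball 0 1)) (h0 : w 0 = 0) :
    ∃ a b g d : ℂ, ‖a‖ ≤ 1 ∧ ‖b‖ ≤ 1 ∧ ‖g‖ ≤ 1 ∧ ‖d‖ ≤ 1 ∧
      taylorCoeff w 1 = a ∧
      taylorCoeff w 2 = (1 - a * starRingEnd ℂ a) * b ∧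
      taylorCoeff w 3 = (1 - a * starRingEnd ℂ a) *
        ((1 - b * starRingEnd ℂ b) * g - starRingEnd ℂ a * b ^ 2) ∧
      taylorCoeff w 4 = (1 - a * starRingEnd ℂ a) *
        ((1 - b * starRingEnd ℂ b) *
          ((1 - g * starRingEnd ℂ g) * d - starRingEnd ℂ b * g ^ 2 -
            2 * starRingEnd ℂ a * b * g) + starRingEnd ℂ a ^ 2 * b ^ 3) := by
  have hmem : (0 : ℂ) ∈ Metric.ball (0 : ℂ) 1 := Metric.mem_ball_self one_pos
  have hφd : DifferentiableOn ℂ (dslope w 0) (Metric.ball 0 1) :=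
    (Complex.differentiableOn_dslope (Metric.ball_mem_nhds 0 one_pos)).mpr hd
  have hφm : ∀ z ∈ Metric.ball (0 : ℂ) 1, ‖dslope w 0 z‖ ≤ 1 := fun z hz => by
    simpa using Complex.norm_dslope_le_div_of_mapsTo_ball hd
      (fun u hu => by rw [h0]; exact Metric.ball_subset_closedBall (hm hu)) hz
  have hz : AnalyticAt ℂ (fun z : ℂ => z) 0 := analyticAt_id
  have hw : ∀ n, taylorCoeff w (n + 1) = taylorCoeff (dslope w 0) n := by
    intro n
    have h := taylorSeries_congr (f := w) (g := fun z => z * dslope w 0 z)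
      fun z _ => by simpa using (sub_smul_dslope_of_zero h0 z).symm
    rw [taylorSeries_mul hz (analyticAt_zero_of_differentiableOn_ball hφd),
      taylorSeries_id] at h
    simpa [PowerSeries.coeff_succ_X_mul] using congrArg (PowerSeries.coeff (n + 1)) h
  obtain ⟨φ₁, hd₁, hm₁, h₁⟩ := exists_schur_step hφd hφm
  obtain ⟨φ₂, hd₂, hm₂, h₂⟩ := exists_schur_step hd₁ hm₁
  obtain ⟨φ₃, hd₃, hm₃, h₃⟩ := exists_schur_step hd₂ hm₂
  have r₁ := taylorCoeff_succ_schur_step hφd hd₁ h₁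
  have r₂ := taylorCoeff_succ_schur_step hd₁ hd₂ h₂
  have r₃ := taylorCoeff_succ_schur_step hd₂ hd₃ h₃
  refine ⟨dslope w 0 0, φ₁ 0, φ₂ 0, φ₃ 0, hφm 0 hmem, hm₁ 0 hmem, hm₂ 0 hmem, hm₃ 0 hmem,
    by rw [hw 0, taylorCoeff_zero], ?_, ?_, ?_⟩
  all_goals
    simp only [hw, r₁, r₂, r₃, Finset.Nat.antidiagonal_succ, Finset.Nat.antidiagonal_zero,
      Finset.sum_cons, Finset.map_cons, Finset.map_singleton,
      Finset.sum_singleton, Function.Embedding.prodMap, Function.Embedding.coeFn_mk,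
      Prod.map, Function.Embedding.refl_apply, taylorCoeff_zero, Nat.succ_eq_add_one,
      zero_add, Nat.reduceAdd]
    ring

/-! ### The determinant as a polynomial in the coefficients of `w` -/

/-- The third Hankel determinant of a function in the class, in terms of the Taylor coefficients
of the Schwarz function. -/
theorem hankelDet_three_one_eq {f w : ℂ → ℂ} (hf : IsNormalizedAnalytic f)
    (hf0 : ∀ z ∈ Metric.ball (0 : ℂ) 1, z ≠ 0 → f z ≠ 0)
    (hwd : DifferentiableOn ℂ w (Metric.ball 0 1)) (hw0 : w 0 = 0)
    (h : ∀ z ∈ Metric.ball (0 : ℂ) 1, starlikeQuotient f z = 1 + w z * Complex.exp (w z)) :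
    144 * hankelDet f 3 1 =
      18 * taylorCoeff w 2 * taylorCoeff w 4 - 4 * taylorCoeff w 1 * taylorCoeff w 2 *
        taylorCoeff w 3 + 9 * taylorCoeff w 2 ^ 3 - 25 * taylorCoeff w 1 ^ 2 * taylorCoeff w 2 ^ 2
        + 5 * taylorCoeff w 1 ^ 4 * taylorCoeff w 2 - 16 * taylorCoeff w 3 ^ 2
        + 16 * taylorCoeff w 1 ^ 3 * taylorCoeff w 3 - 4 * taylorCoeff w 1 ^ 6 := by
  obtain ⟨hfd, hf00, hf1⟩ := hf
  have hfa := analyticAt_zero_of_differentiableOn_ball hfd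
  have hwa := analyticAt_zero_of_differentiableOn_ball hwd
  have hea : AnalyticAt ℂ (fun z => Complex.exp (w z)) 0 := hwa.cexp
  have hz : AnalyticAt ℂ (fun z : ℂ => z) 0 := analyticAt_id
  have hwe : AnalyticAt ℂ (fun z => w z * Complex.exp (w z)) 0 := hwa.mul hea
  have hq : AnalyticAt ℂ (fun z => 1 + w z * Complex.exp (w z)) 0 := analyticAt_const.add hwe
  have hexp : taylorSeries (deriv fun z => Complex.exp (w z)) =
      taylorSeries (fun z => Complex.exp (w z)) * taylorSeries (deriv w) := by
    rw [← taylorSeries_mul hea hwa.deriv]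
    refine taylorSeries_congr fun z hz => ?_
    exact deriv_cexp (hwd.differentiableAt (Metric.isOpen_ball.mem_nhds hz))
  have hfode : PowerSeries.X * taylorSeries (deriv f) = taylorSeries f *
      (1 + taylorSeries w * taylorSeries (fun z => Complex.exp (w z))) := by
    rw [← taylorSeries_id, ← taylorSeries_mul hz hfa.deriv, ← taylorSeries_mul hwa hea,
      ← map_one PowerSeries.C, ← taylorSeries_const,
      ← taylorSeries_add analyticAt_const hwe, ← taylorSeries_mul hfa hq]
    refine taylorSeries_congr fun z hz => ?_
    rw [← h z hz, starlikeQuotient]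
    -- At the origin both sides vanish, whatever value fills the quotient.
    split_ifs with h0
    · simp [h0, hf00]
    · have := hf0 z hz h0
      field_simp
  have hE := fun n => congrArg (PowerSeries.coeff n) hexp
  have hF := fun n => congrArg (PowerSeries.coeff n) hfode
  simp only [PowerSeries.coeff_mul, coeff_taylorSeries, taylorCoeff_deriv] at hE
  have hE0 : taylorCoeff (fun z => Complex.exp (w z)) 0 = 1 := by simp [hw0]
  have hW0 : taylorCoeff w 0 = 0 := by simp [hw0]
  have hA0 : taylorCoeff f 0 = 0 := by simp [hf00]
  have hA1 : taylorCoeff f 1 = 1 := by rw [taylorCoeff_one, hf1]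
  have e1 := hE 0
  have e2 := hE 1
  have e3 := hE 2
  -- Coefficient `n` reads `(n - 1) a_n = ...` once `a_n` is cancelled, so it determines `a_n` only
  -- from `n = 2` on.
  have f2 := hF 2
  have f3 := hF 3
  have f4 := hF 4
  have f5 := hF 5
  rw [PowerSeries.coeff_succ_X_mul] at f2 f3 f4 f5
  simp only [mul_add, mul_one, map_add, PowerSeries.coeff_mul, coeff_taylorSeries,
    taylorCoeff_deriv, Finset.Nat.antidiagonal_succ, Finset.Nat.antidiagonal_zero,
      Finset.sum_cons, Finset.map_cons, Finset.map_singleton,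
      Finset.sum_singleton, Function.Embedding.prodMap, Function.Embedding.coeFn_mk,
      Prod.map, Function.Embedding.refl_apply, Nat.succ_eq_add_one,
      zero_add, Nat.reduceAdd, hE0, hW0, hA0, hA1, Nat.cast_zero, Nat.cast_one,
      Nat.cast_ofNat, zero_mul, mul_zero, one_mul, add_zero] at e1 e2 e3 f2 f3 f4 f5
  have hdet : hankelDet f 3 1 = taylorCoeff f 3 * taylorCoeff f 5 - taylorCoeff f 4 ^ 2
      - taylorCoeff f 2 ^ 2 * taylorCoeff f 5
      + 2 * taylorCoeff f 2 * taylorCoeff f 3 * taylorCoeff f 4 - taylorCoeff f 3 ^ 3 := by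
    simp [hankelDet, Matrix.det_fin_three, hA1]
    ring
  rw [hdet]
  generalize taylorCoeff (fun z => Complex.exp (w z)) 1 = E1 at *
  generalize taylorCoeff (fun z => Complex.exp (w z)) 2 = E2 at *
  generalize taylorCoeff (fun z => Complex.exp (w z)) 3 = E3 at *
  generalize taylorCoeff w 1 = c1 at *
  generalize taylorCoeff w 2 = c2 at *
  generalize taylorCoeff w 3 = c3 at *
  generalize taylorCoeff w 4 = c4 at *
  generalize taylorCoeff f 2 = a2 at *
  generalize taylorCoeff f 3 = a3 at *
  generalize taylorCoeff f 4 = a4 at *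
  generalize taylorCoeff f 5 = a5 at *
  have E1' : E1 = c1 := by linear_combination e1
  subst E1'
  have E2' : E2 = c2 + E1 ^ 2 / 2 := by linear_combination e2 / 2
  subst E2'
  have E3' : E3 = c3 + E1 * c2 + E1 ^ 3 / 6 := by linear_combination e3 / 3
  subst E3'
  have a2' : a2 = E1 := by linear_combination f2
  subst a2'
  have a3' : a3 = c2 / 2 + a2 ^ 2 := by linear_combination f3 / 2
  subst a3'
  have a4' : a4 = c3 / 3 + 7 / 6 * a2 * c2 + 5 / 6 * a2 ^ 3 := by linear_combination f4 / 3
  subst a4'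
  have a5' : a5 = (c4 + 10 / 3 * a2 * c3 + 3 / 2 * c2 ^ 2 + 37 / 6 * a2 ^ 2 * c2
      + 5 / 2 * a2 ^ 4) / 4 := by linear_combination f5 / 4
  subst a5'
  ring

/-! ### The estimate in the Schur parameters -/

/-- The two-variable estimate left after the triangle inequality. -/
theorem majorant_le {x y : ℝ} (hx0 : 0 ≤ x) (hx1 : x ≤ 1) (hy0 : 0 ≤ y) (hy1 : y ≤ 1) :
    2 * (1 - x ^ 2) ^ 2 * x ^ 2 * y ^ 4
      + (1 - x ^ 2) ^ 2 * (4 * x ^ 2 + 9 * (1 - x ^ 2)) * y ^ 3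
      + x ^ 2 * (1 - x ^ 2) * (16 * x ^ 2 + 25 * (1 - x ^ 2)) * y ^ 2
      + 5 * x ^ 4 * (1 - x ^ 2) * y + 4 * x ^ 6
      + (1 - x ^ 2) * (1 - y ^ 2) * x *
        (4 * (1 - x ^ 2) * y ^ 2 + 4 * (1 - x ^ 2) * y + 16 * x ^ 2)
      + (1 - x ^ 2) ^ 2 * (1 - y ^ 2) * (16 + 2 * y ^ 2) ≤ 16 := by
  have ht : 0 ≤ 1 - x ^ 2 := by nlinarith
  have hs : 0 ≤ 1 - y ^ 2 := by nlinarith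
  -- With `t = 1 - x^2`, write `16 = 16 (t + x^2)^3`. The squares in `h1` and `h2` absorb the terms
  -- odd in `x`; `h3` to `h6` are what remains at `x^4 t`, `x^2 t^2`, `t^3` and `x^6`. The gap is
  -- exactly the sum of the six.
  have h1 : 0 ≤ 2 * (1 - x ^ 2) ^ 2 * (1 - y ^ 2) * (1 + y) * (x - y) ^ 2 := by positivity
  have h2 : 0 ≤ 8 * (1 - x ^ 2) * (1 - y ^ 2) * x ^ 2 * (1 - x) ^ 2 := by positivity
  have h3 : 0 ≤ x ^ 4 * (1 - x ^ 2) * (32 - 5 * y) :=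
    mul_nonneg (by positivity) (by linarith)
  have p2 : y ^ 2 ≤ y := by nlinarith
  have h4 : 0 ≤ x ^ 2 * (1 - x ^ 2) ^ 2 * (48 - 2 * y ^ 4 - 4 * y ^ 3 - 25 * y ^ 2
      - 2 * (1 - y ^ 2) * (1 + y) * (1 + y ^ 2) - 8 * (1 - y ^ 2)
      - (1 - y ^ 2) * (16 + 2 * y ^ 2)) := by
    refine mul_nonneg (by positivity) ?_
    have p3 : 0 ≤ y ^ 3 := by positivity
    have p4 : 0 ≤ y ^ 4 := by positivity
    have p5 : 0 ≤ y ^ 5 := by positivity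
    nlinarith [pow_le_one₀ (n := 3) hy0 hy1, pow_le_one₀ (n := 2) hy0 hy1]
  have h5 : 0 ≤ (1 - x ^ 2) ^ 3 * (y ^ 2 * (12 - 11 * y + 4 * y ^ 2 + 2 * y ^ 3)) := by
    refine mul_nonneg (by positivity) (mul_nonneg (by positivity) ?_)
    nlinarith [pow_nonneg hy0 2, pow_nonneg hy0 3]
  have h6 : 0 ≤ 12 * x ^ 6 := by positivity
  linarith

/-- The estimate for the Hankel functional in terms of Schur parameters. -/
theorem norm_schur_functional_le {a b g d : ℂ} (ha : ‖a‖ ≤ 1) (hb : ‖b‖ ≤ 1) (hg : ‖g‖ ≤ 1)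
    (hd : ‖d‖ ≤ 1) {c₂ c₃ c₄ : ℂ}
    (h₂ : c₂ = (1 - a * starRingEnd ℂ a) * b)
    (h₃ : c₃ = (1 - a * starRingEnd ℂ a) *
        ((1 - b * starRingEnd ℂ b) * g - starRingEnd ℂ a * b ^ 2))
    (h₄ : c₄ = (1 - a * starRingEnd ℂ a) *
        ((1 - b * starRingEnd ℂ b) *
          ((1 - g * starRingEnd ℂ g) * d - starRingEnd ℂ b * g ^ 2 -
            2 * starRingEnd ℂ a * b * g) + starRingEnd ℂ a ^ 2 * b ^ 3)) :
    ‖18 * c₂ * c₄ - 4 * a * c₂ * c₃ + 9 * c₂ ^ 3 - 25 * a ^ 2 * c₂ ^ 2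
        + 5 * a ^ 4 * c₂ - 16 * c₃ ^ 2 + 16 * a ^ 3 * c₃ - 4 * a ^ 6‖ ≤ 16 := by
  set x := ‖a‖ with hx
  set y := ‖b‖ with hy
  set r := ‖g‖ with hr
  have hx0 : 0 ≤ x := norm_nonneg a
  have hy0 : 0 ≤ y := norm_nonneg b
  have hr0 : 0 ≤ r := norm_nonneg g
  have ht : 0 ≤ 1 - x ^ 2 := by nlinarith
  have hs : 0 ≤ 1 - y ^ 2 := by nlinarith
  have hq : 0 ≤ 1 - r ^ 2 := by nlinarith
  have haa : a * starRingEnd ℂ a = ((x ^ 2 : ℝ) : ℂ) := by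
    rw [Complex.mul_conj, Complex.normSq_eq_norm_sq]
  have hbb : b * starRingEnd ℂ b = ((y ^ 2 : ℝ) : ℂ) := by
    rw [Complex.mul_conj, Complex.normSq_eq_norm_sq]
  have hgg : g * starRingEnd ℂ g = ((r ^ 2 : ℝ) : ℂ) := by
    rw [Complex.mul_conj, Complex.normSq_eq_norm_sq]
  have hn : ∀ {c : ℝ}, 0 ≤ c → ∀ z : ℂ, ‖(c : ℂ) * z‖ = c * ‖z‖ := fun hc z => by
    rw [norm_mul, Complex.norm_of_nonneg hc]
  have key : 18 * c₂ * c₄ - 4 * a * c₂ * c₃ + 9 * c₂ ^ 3 - 25 * a ^ 2 * c₂ ^ 2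
        + 5 * a ^ 4 * c₂ - 16 * c₃ ^ 2 + 16 * a ^ 3 * c₃ - 4 * a ^ 6 =
      ((2 * (1 - x ^ 2) ^ 2 : ℝ) : ℂ) * (starRingEnd ℂ a ^ 2 * b ^ 4)
      + (((1 - x ^ 2) ^ 2 * (4 * x ^ 2 + 9 * (1 - x ^ 2)) : ℝ) : ℂ) * b ^ 3
      - (((1 - x ^ 2) * (16 * x ^ 2 + 25 * (1 - x ^ 2)) : ℝ) : ℂ) * (a ^ 2 * b ^ 2)
      + ((5 * (1 - x ^ 2) : ℝ) : ℂ) * (a ^ 4 * b) - ((4 : ℝ) : ℂ) * a ^ 6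
      - ((4 * (1 - x ^ 2) ^ 2 * (1 - y ^ 2) : ℝ) : ℂ) * (starRingEnd ℂ a * b ^ 2 * g)
      - ((4 * (1 - x ^ 2) ^ 2 * (1 - y ^ 2) : ℝ) : ℂ) * (a * b * g)
      + ((16 * (1 - x ^ 2) * (1 - y ^ 2) : ℝ) : ℂ) * (a ^ 3 * g)
      - (((1 - x ^ 2) ^ 2 * (1 - y ^ 2) * (16 + 2 * y ^ 2) : ℝ) : ℂ) * g ^ 2
      + ((18 * (1 - x ^ 2) ^ 2 * (1 - y ^ 2) * (1 - r ^ 2) : ℝ) : ℂ) * (b * d) := by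
    rw [haa] at h₂ h₃ h₄
    rw [hbb] at h₃ h₄
    rw [hgg] at h₄
    rw [h₂, h₃, h₄]
    push_cast at haa hbb ⊢
    linear_combination (4 * (1 - (x : ℂ) ^ 2) ^ 2 * b ^ 3
      - 16 * (1 - (x : ℂ) ^ 2) * a ^ 2 * b ^ 2) * haa
      - 18 * (1 - (x : ℂ) ^ 2) ^ 2 * (1 - (y : ℂ) ^ 2) * g ^ 2 * hbb
  rw [key]
  refine le_trans ?_ (majorant_le hx0 ha hy0 hb)
  refine (norm_add_le _ _).trans ?_
  refine (add_le_add_left ((norm_sub_le _ _).trans (add_le_add_left ((norm_add_le _ _).trans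
    (add_le_add_left ((norm_sub_le _ _).trans (add_le_add_left ((norm_sub_le _ _).trans
    (add_le_add_left ((norm_sub_le _ _).trans (add_le_add_left ((norm_add_le _ _).trans
    (add_le_add_left ((norm_sub_le _ _).trans (add_le_add_left (norm_add_le _ _) _)) _)) _))
      _)) _)) _)) _)) _).trans ?_
  rw [hn (by positivity), hn (by positivity), hn (by positivity), hn (by positivity),
    hn (by positivity), hn (by positivity), hn (by positivity), hn (by positivity),
    hn (by positivity), hn (by positivity)]
  simp only [norm_mul, norm_pow, RCLike.norm_conj, ← hx, ← hy, ← hr]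
  have k1 : 0 ≤ (1 - x ^ 2) ^ 2 * (1 - y ^ 2) * (4 * x * y ^ 2 + 4 * x * y) * (1 - r) :=
    mul_nonneg (by positivity) (by linarith)
  have k2 : 0 ≤ 16 * (1 - x ^ 2) * (1 - y ^ 2) * x ^ 3 * (1 - r) :=
    mul_nonneg (by positivity) (by linarith)
  have k3 : 0 ≤ 18 * (1 - x ^ 2) ^ 2 * (1 - y ^ 2) * (1 - r ^ 2) * y * (1 - ‖d‖) :=
    mul_nonneg (by positivity) (by linarith)
  -- `k1` to `k3` replace `r` (in its linear terms) and `‖d‖` by 1. For the terms in `r^2`, moving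
  -- to `r = 1` gains a multiple of `16 + 2y^2 - 18y = 2(1 - y)(8 - y)`.
  have k4 : 0 ≤ (1 - x ^ 2) ^ 2 * (1 - y ^ 2) * (1 - r ^ 2) * (2 * ((1 - y) * (8 - y))) :=
    mul_nonneg (by positivity) (mul_nonneg two_pos.le
      (mul_nonneg (by linarith) (by linarith)))
  linarith

/-! ### The extremal function -/

theorem taylorCoeff_cube (n : ℕ) :
    taylorCoeff (fun z : ℂ => z ^ 3) n = if n = 3 then 1 else 0 := by
  have hz : AnalyticAt ℂ (fun z : ℂ => z) 0 := analyticAt_id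
  have hzz : AnalyticAt ℂ (fun z : ℂ => z * z) 0 := hz.mul hz
  have h : taylorSeries (fun z : ℂ => z ^ 3) = PowerSeries.X ^ 3 := by
    rw [pow_three, ← taylorSeries_id, ← taylorSeries_mul hz hz,
      ← taylorSeries_mul hz hzz]
    simp only [pow_three]
  rw [← coeff_taylorSeries, h, PowerSeries.coeff_X_pow]

theorem hasDerivAt_extremal (z : ℂ) :
    HasDerivAt (fun z : ℂ => z * Complex.exp ((Complex.exp (z ^ 3) - 1) / 3))
      (Complex.exp ((Complex.exp (z ^ 3) - 1) / 3) * (1 + z ^ 3 * Complex.exp (z ^ 3))) z := by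
  have h := (hasDerivAt_id z).mul
    ((((hasDerivAt_pow 3 z).cexp.sub_const 1).div_const 3).cexp)
  refine h.congr_deriv ?_
  simp only [id]
  push_cast
  ring

theorem extremal_isNormalizedAnalytic :
    IsNormalizedAnalytic fun z : ℂ => z * Complex.exp ((Complex.exp (z ^ 3) - 1) / 3) := by
  refine ⟨fun z _ => (hasDerivAt_extremal z).differentiableAt.differentiableWithinAt, ?_, ?_⟩
  · simp
  · rw [(hasDerivAt_extremal 0).deriv]; simp

theorem extremal_ne_zero {z : ℂ} (hz : z ≠ 0) :
    z * Complex.exp ((Complex.exp (z ^ 3) - 1) / 3) ≠ 0 :=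
  mul_ne_zero hz (Complex.exp_ne_zero _)

theorem starlikeQuotient_extremal (z : ℂ) :
    starlikeQuotient (fun z : ℂ => z * Complex.exp ((Complex.exp (z ^ 3) - 1) / 3)) z =
      1 + z ^ 3 * Complex.exp (z ^ 3) := by
  rw [starlikeQuotient]
  split_ifs with h
  · simp [h]
  · rw [(hasDerivAt_extremal z).deriv]
    have := Complex.exp_ne_zero ((Complex.exp (z ^ 3) - 1) / 3)
    field_simp

theorem theorem2p1 :
    (∀ f ∈ StarlikeCardioid, ‖hankelDet f 3 1‖ ≤ 1 / 9) ∧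
      (fun z : ℂ => z * Complex.exp ((Complex.exp (z ^ 3) - 1) / 3)) ∈ StarlikeCardioid ∧
      ‖hankelDet (fun z : ℂ => z * Complex.exp ((Complex.exp (z ^ 3) - 1) / 3)) 3 1‖ = 1 / 9 := by
  have hcube : DifferentiableOn ℂ (fun z : ℂ => z ^ 3) (Metric.ball 0 1) := by fun_prop
  refine ⟨?_, ⟨extremal_isNormalizedAnalytic, fun z _ => extremal_ne_zero, fun z => z ^ 3, hcube,
    ?_, by simp, fun z _ => starlikeQuotient_extremal z⟩, ?_⟩
  · rintro f ⟨hf, hf0, w, hwd, hwm, hw0, hw⟩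
    obtain ⟨a, b, g, d, ha, hb, hg, hd, h₁, h₂, h₃, h₄⟩ := exists_schur_parameters hwd hwm hw0
    have hle := norm_schur_functional_le ha hb hg hd h₂ h₃ h₄
    rw [← h₁, ← hankelDet_three_one_eq hf hf0 hwd hw0 hw, norm_mul] at hle
    norm_num at hle
    linarith
  · intro z hz
    rw [mem_ball_zero_iff] at hz ⊢
    rw [norm_pow]
    exact pow_lt_one₀ (norm_nonneg z) hz (by norm_num)
  · have h := hankelDet_three_one_eq extremal_isNormalizedAnalytic
      (fun z _ => extremal_ne_zero) hcube (by simp) fun z _ => starlikeQuotient_extremal z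
    -- For `w = z^3` only the term `-16 c_3^2` survives, so `144 H_3(1) = -16`.
    simp only [taylorCoeff_cube] at h
    norm_num at h
    have h' : hankelDet (fun z : ℂ => z * Complex.exp ((Complex.exp (z ^ 3) - 1) / 3)) 3 1 =
        -(1 / 9) := by linear_combination h / 144
    rw [h']
    norm_num
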